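/- Let $\gamma\colon[0,1]\to\mathbb{R}^3$ be a simple loop, that is, a continuous map with $\gamma(0)=\gamma(1)$ that is injective on $[0,1)$. A parallelogram is a quadruple $(A,B,C,D)$ of points in $\mathbb{R}^3$ such that either $A,B,C$ are not collinear and $B-A=C-D$ (a parallelogram in the usual sense), or $A,B,C,D$ are four pairwise distinct points on a line and $(A,B,C,D)$ is the limit of a sequence of parallelograms in the usual sense (a degenerate parallelogram). The loop $\gamma$ inscribes a parallelogram if all four of its vertices $A,B,C,D$ lie in $\gamma([0,1])$. Then $\gamma$ inscribes a parallelogram (Hadwiger's 1971 conjecture). In fact, the set of all vertices of parallelograms inscribed in $\gamma$ is a dense subset of $\gamma([0,1])$. -/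

import Mathlib

open Filter Topology

/-- Euclidean 3-space. -/
abbrev E3 : Type := EuclideanSpace ℝ (Fin 3)

/-- A simple loop in 3-space: a continuous closed curve on `[0,1]` that is injective except that its
two endpoints coincide. -/
structure IsSimpleLoop (γ : unitInterval → E3) : Prop where
  continuous : Continuous γ
  closed : γ 0 = γ 1
  injOn : Set.InjOn γ (Set.Ico 0 1)

/-- `P 0, P 1, P 2, P 3` are, in this cyclic order, the vertices of a parallelogram in the
usual sense: three of the vertices are not on a line, and the directed side from `P 0` to `P 1`
equals the directed side from `P 3` to `P 2`. -/
def IsProperParallelogram (P : Fin 4 → E3) : Prop :=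
  AffineIndependent ℝ ![P 0, P 1, P 2] ∧ P 1 - P 0 = P 2 - P 3

/-- A degenerate parallelogram: four pairwise distinct points on a line that are the limit of a
sequence of parallelograms. -/
def IsDegenerateParallelogram (P : Fin 4 → E3) : Prop :=
  Function.Injective P ∧ Collinear ℝ (Set.range P) ∧
    ∃ Q : ℕ → Fin 4 → E3, (∀ n, IsProperParallelogram (Q n)) ∧ Tendsto Q atTop (𝓝 P)

/-- A parallelogram, where degenerate ones are allowed. -/
def IsParallelogram (P : Fin 4 → E3) : Prop :=
  IsProperParallelogram P ∨ IsDegenerateParallelogram P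

/-- The curve `γ` inscribes the parallelogram `P`: its image contains the four vertices. -/
def Inscribes (γ : unitInterval → E3) (P : Fin 4 → E3) : Prop :=
  IsParallelogram P ∧ ∀ i, P i ∈ Set.range γ

/-- The set of all vertices of all parallelograms inscribed in `γ`. -/
def inscribedVertices (γ : unitInterval → E3) : Set E3 :=
  {x | ∃ P : Fin 4 → E3, Inscribes γ P ∧ x ∈ Set.range P}

/-!
A parallelogram inscribed in the loop `γ` amounts to four distinct points of it with
`γ b - γ a = γ c - γ d`; if they happen to be collinear, moving two of them by the same small vector
off the line shows that they form a degenerate parallelogram (`isParallelogram_of_injective`).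

Such points come from splitting a curve in `ℝ⁴`. Let `m` be the distribution function of a
probability measure on `[0, 1]` and let `h = (m, γ)`. A point `x` of the `ℓ¹` unit sphere in `ℝ⁵`
cuts `[0, 1]` into five intervals of lengths `|x j|`, and the sum of the increments of `h` over these
intervals, weighted by the signs of the `x j`, is a continuous odd function of `x` with values in
`ℝ⁴`. By the Borsuk–Ulam theorem it has a zero. At a zero the intervals of either sign carry
half of the total increment, and one of the two signs occurs at most twice. This gives
`a ≤ b ≤ c ≤ d` with `γ b - γ a + γ d - γ c = 0`, because `γ` is closed, and with
`m b - m a + m d - m c = 1 / 2`. Since `γ` is simple, any coincidence among the four points would make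
this mass `0` or `1`. If the measure lives on a short arc, then the mass condition also forces one of
the four points to lie in this arc, which gives the density of the vertices.

The Borsuk–Ulam theorem is deduced from a form of Tucker's lemma, proved with chains modulo two
whose simplices are arbitrary finite lists of points. The sphere is an iterated suspension
`z_{k+1} = c + (-c)`, where `c` is the cone over `z_k`, made fine by barycentric subdivision. Fan's
functional counts the simplices whose labels, sorted by absolute value, alternate in sign and begin
with `+`. Its coboundary is itself plus its antipodal image (`lift_fan_faces`), so that its value on
`z_{k+1}` equals its value on `∂c = z_k`, and hence `1` in every dimension; but it vanishes on
simplices with more vertices than there are absolute values of labels if no simplex has opposite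
labels.
-/

/-! ### Chains of finite lists modulo two -/

/-- Chains with coefficients in `ZMod 2` on finite lists of points. A list of length `k` plays the
role of a `(k - 1)`-simplex; the empty list is present, so the complex is augmented. -/
abbrev ListChain (X : Type*) : Type _ := List X →₀ ZMod 2

namespace ListChain

variable {X Y : Type*}

/-- The chain consisting of a single list. -/
noncomputable def simplex (l : List X) : ListChain X := Finsupp.single l 1

/-- The join with a point: it prepends `x` to every list of the chain. -/
noncomputable def cone (x : X) : ListChain X →ₗ[ZMod 2] ListChain X :=
  Finsupp.lmapDomain (ZMod 2) (ZMod 2) (List.cons x)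

/-- The boundary of one list, that is, the sum of the lists obtained by omitting one entry. -/
noncomputable def faces : List X → ListChain X
  | [] => 0
  | x :: l => simplex l + cone x (faces l)

/-- The linear functional or operator with prescribed values on lists. -/
noncomputable def lift {M : Type*} [AddCommGroup M] [Module (ZMod 2) M] (F : List X → M) :
    ListChain X →ₗ[ZMod 2] M :=
  Finsupp.linearCombination (ZMod 2) F

/-- The boundary operator. -/
noncomputable def bdry : ListChain X →ₗ[ZMod 2] ListChain X := lift faces

/-- The chain map induced by a map of points. -/
noncomputable def push (f : X → Y) : ListChain X →ₗ[ZMod 2] ListChain Y :=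
  Finsupp.lmapDomain (ZMod 2) (ZMod 2) (List.map f)

/-- The chains all of whose lists belong to `s`. -/
noncomputable def on (s : Set (List X)) : Submodule (ZMod 2) (ListChain X) :=
  Finsupp.supported (ZMod 2) (ZMod 2) s

@[simp] theorem lift_simplex {M : Type*} [AddCommGroup M] [Module (ZMod 2) M] (F : List X → M)
    (l : List X) : lift F (simplex l) = F l := by
  simp [lift, simplex]

@[simp] theorem cone_simplex (x : X) (l : List X) : cone x (simplex l) = simplex (x :: l) := by
  simp [cone, simplex]

@[simp] theorem push_simplex (f : X → Y) (l : List X) :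
    push f (simplex l) = simplex (l.map f) := by
  simp [push, simplex]

@[simp] theorem bdry_simplex (l : List X) : bdry (simplex l) = faces l := by
  simp [bdry]

theorem add_self (c : ListChain X) : c + c = 0 := 
  Finsupp.ext fun l => CharTwo.add_self_eq_zero (c l)

theorem hom_ext {M : Type*} [AddCommGroup M] [Module (ZMod 2) M]
    {φ ψ : ListChain X →ₗ[ZMod 2] M} (h : ∀ l, φ (simplex l) = ψ (simplex l)) : φ = ψ :=
  Finsupp.lhom_ext' fun l => LinearMap.ext_ring (h l)

theorem on_eq_span (s : Set (List X)) : on s = Submodule.span (ZMod 2) (simplex '' s) :=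
  Finsupp.supported_eq_span_single (ZMod 2) s

theorem simplex_mem_on {s : Set (List X)} {l : List X} (h : l ∈ s) : simplex l ∈ on s :=
  Finsupp.single_mem_supported _ _ h

theorem on_mono {s t : Set (List X)} (h : s ⊆ t) : on s ≤ on t := Finsupp.supported_mono h

theorem map_mem_of_mem_on {M : Type*} [AddCommGroup M] [Module (ZMod 2) M]
    {φ : ListChain X →ₗ[ZMod 2] M} {s : Set (List X)} {p : Submodule (ZMod 2) M}
    (h : ∀ l ∈ s, φ (simplex l) ∈ p) {c : ListChain X} (hc : c ∈ on s) : φ c ∈ p := by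
  rw [on_eq_span] at hc
  have : Submodule.span (ZMod 2) (simplex '' s) ≤ p.comap φ := by
    rw [Submodule.span_le]
    rintro _ ⟨l, hl, rfl⟩
    exact h l hl
  exact this hc

theorem eq_of_mem_on {M : Type*} [AddCommGroup M] [Module (ZMod 2) M]
    {φ ψ : ListChain X →ₗ[ZMod 2] M} {s : Set (List X)}
    (h : ∀ l ∈ s, φ (simplex l) = ψ (simplex l)) {c : ListChain X} (hc : c ∈ on s) :
    φ c = ψ c := by
  have : (φ - ψ) c ∈ (⊥ : Submodule (ZMod 2) M) :=
    map_mem_of_mem_on (fun l hl => by simp [h l hl]) hc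
  simpa [sub_eq_zero] using this

theorem bdry_cone (x : X) (c : ListChain X) : bdry (cone x c) = c + cone x (bdry c) := by
  have : bdry ∘ₗ cone x = LinearMap.id + cone x ∘ₗ bdry := hom_ext fun l => by simp [faces]
  exact LinearMap.congr_fun this c

theorem bdry_faces (l : List X) : bdry (faces l) = 0 := by
  induction l with
  | nil => simp [faces]
  | cons x l ih => simp [faces, bdry_cone, ih, add_self]

theorem push_cone (f : X → Y) (x : X) (c : ListChain X) :
    push f (cone x c) = cone (f x) (push f c) := by
  have : push f ∘ₗ cone x = cone (f x) ∘ₗ push f := hom_ext fun l => by simp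
  exact LinearMap.congr_fun this c

theorem push_faces (f : X → Y) (l : List X) : push f (faces l) = faces (l.map f) := by
  induction l with
  | nil => simp [faces]
  | cons x l ih => simp [faces, push_cone, ih]

theorem lift_push {M : Type*} [AddCommGroup M] [Module (ZMod 2) M] (F : List Y → M) (f : X → Y)
    (c : ListChain X) : lift F (push f c) = lift (fun l => F (l.map f)) c := by
  have : lift F ∘ₗ push f = lift (fun l => F (l.map f)) := hom_ext fun l => by simp
  exact LinearMap.congr_fun this c

theorem lift_cone {M : Type*} [AddCommGroup M] [Module (ZMod 2) M] (F : List X → M) (x : X)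
    (c : ListChain X) : lift F (cone x c) = lift (fun l => F (x :: l)) c := by
  have : lift F ∘ₗ cone x = lift (fun l => F (x :: l)) := hom_ext fun l => by simp
  exact LinearMap.congr_fun this c

theorem faces_mem_on (l : List X) :
    faces l ∈ on {l' | l'.length + 1 = l.length ∧ l'.Sublist l} := by
  induction l with
  | nil => simp [faces]
  | cons x l ih =>
    refine add_mem (simplex_mem_on ⟨by simp, by simp⟩) (map_mem_of_mem_on (fun l' hl' => ?_) ih)
    rw [cone_simplex]
    exact simplex_mem_on ⟨by simpa using hl'.1, hl'.2.cons_cons x⟩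

/-! ### Barycentric subdivision -/

section Subdivision

variable {E : Type*} [NormedAddCommGroup E] [NormedSpace ℝ E]

/-- The barycenter of a list of points. -/
noncomputable def bary (l : List E) : E := (l.length : ℝ)⁻¹ • l.sum

/-- Barycentric subdivision of chains of lists of length `n`. -/
noncomputable def sd : ℕ → ListChain E →ₗ[ZMod 2] ListChain E
  | 0 => LinearMap.id
  | n + 1 => lift fun l => cone (bary l) (sd n (faces l))

theorem sd_simplex (n : ℕ) (l : List E) :
    sd (n + 1) (simplex l) = cone (bary l) (sd n (faces l)) := by
  rw [sd, lift_simplex]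

theorem bdry_sd (n : ℕ) {c : ListChain E} (hc : c ∈ on {l | l.length = n + 1}) :
    bdry (sd (n + 1) c) = sd n (bdry c) := by
  have key : ∀ l : List E, l.length = n + 1 → bdry (sd (n + 1) (simplex l)) = sd n (faces l) := by
    intro l hl
    induction n generalizing c l with
    | zero =>
      obtain ⟨x, rfl⟩ := List.length_eq_one_iff.1 hl
      rw [sd_simplex]
      simp [sd, faces]
    | succ n ih =>
      have hf : faces l ∈ on {l' : List E | l'.length = n + 1} :=
        on_mono (fun l' hl' => by
          have := hl'.1
          simp only [Set.mem_ofPred_eq] at hl ⊢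
          omega) (faces_mem_on l)
      have h : (bdry ∘ₗ sd (n + 1)) (faces l) = (sd n ∘ₗ bdry) (faces l) :=
        eq_of_mem_on (fun l' hl' => by
          rw [LinearMap.comp_apply, LinearMap.comp_apply, bdry_simplex]
          exact ih (simplex_mem_on hl') l' hl') hf
      rw [LinearMap.comp_apply, LinearMap.comp_apply, bdry_faces, map_zero] at h
      rw [sd_simplex, bdry_cone, h, map_zero, add_zero]
  have h : (bdry ∘ₗ sd (n + 1)) c = (sd n ∘ₗ bdry) c :=
    eq_of_mem_on (fun l hl => by
      rw [LinearMap.comp_apply, LinearMap.comp_apply, bdry_simplex]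
      exact key l hl) hc
  exact h

theorem bary_map_neg (l : List E) : bary (l.map fun x => -x) = -bary l := by
  have : (l.map fun x => -x).sum = -l.sum := by
    induction l with
    | nil => simp
    | cons x l ih => simp [ih, add_comm]
  simp [bary, this]

theorem sd_push_neg (n : ℕ) (c : ListChain E) :
    sd n (push (fun x => -x) c) = push (fun x => -x) (sd n c) := by
  induction n generalizing c with
  | zero => simp [sd]
  | succ n ih =>
    have : sd (n + 1) ∘ₗ push (fun x : E => -x) = push (fun x => -x) ∘ₗ sd (n + 1) :=
      hom_ext fun l => by
        simp only [LinearMap.comp_apply, push_simplex, sd_simplex]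
        rw [push_cone, bary_map_neg, ← ih, push_faces]
    exact LinearMap.congr_fun this c

theorem bary_mem {K : Set E} (hK : Convex ℝ K) {l : List E} (hl : l ≠ []) (h : ∀ v ∈ l, v ∈ K) :
    bary l ∈ K := by
  have hpos : (0 : ℝ) < l.length := by
    exact_mod_cast List.length_pos_iff.2 hl
  have hs : l.sum = ∑ i : Fin l.length, l[i] := by
    simp
  rw [bary, hs, Finset.smul_sum]
  refine hK.sum_mem (fun _ _ => by positivity) ?_ fun i _ => h _ (List.getElem_mem _)
  simp [hpos.ne']

theorem dist_bary_le {l : List E} {d : ℝ} {v : E} (hv : v ∈ l)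
    (h : ∀ w ∈ l, dist w v ≤ d) : dist v (bary l) ≤ (1 - (l.length : ℝ)⁻¹) * d := by
  have hpos : (0 : ℝ) < l.length := by
    exact_mod_cast List.length_pos_of_mem hv
  have key : ∀ l : List E, (∀ w ∈ l, dist w v ≤ d) →
      ‖l.sum - (l.length : ℝ) • v‖ ≤ l.length * d := by
    intro l
    induction l with
    | nil => simp
    | cons x l ih =>
      intro h
      have h1 := ih fun w hw => h w (List.mem_cons_of_mem _ hw)
      have h2 := h x List.mem_cons_self
      rw [dist_eq_norm] at h2
      have e : (x :: l).sum - (((x :: l).length : ℕ) : ℝ) • v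
          = (x - v) + (l.sum - (l.length : ℝ) • v) := by
        simp only [List.sum_cons, List.length_cons, Nat.cast_add, Nat.cast_one, add_smul, one_smul]
        abel
      rw [e]
      refine (norm_add_le _ _).trans ?_
      push_cast [List.length_cons]
      linarith
  classical
  have hp := List.perm_cons_erase hv
  -- The entry `v` itself contributes nothing to the sum of the distances.
  have h1 := key (l.erase v) fun w hw => h w (List.mem_of_mem_erase hw)
  have hlen : ((l.erase v).length : ℝ) = l.length - 1 := by
    have := hp.length_eq
    rw [List.length_cons] at this
    rw [this]; push_cast; ring
  have hsum : l.sum = v + (l.erase v).sum := by rw [hp.sum_eq, List.sum_cons]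
  have e : v - bary l = -((l.length : ℝ)⁻¹ • ((l.erase v).sum - ((l.erase v).length : ℝ) • v)) := by
    rw [bary, hsum, hlen, smul_sub, smul_add, smul_smul, mul_sub, inv_mul_cancel₀ hpos.ne',
      sub_smul, one_smul, mul_one]
    abel
  rw [dist_eq_norm, e, norm_neg, norm_smul, norm_inv, Real.norm_natCast]
  calc (l.length : ℝ)⁻¹ * _ ≤ (l.length : ℝ)⁻¹ * ((l.erase v).length * d) := by gcongr
    _ = _ := by rw [hlen]; field_simp

/-- The lists of length `n` of points of `K` with all mutual distances at most `d`. -/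
def small (n : ℕ) (d : ℝ) (K : Set E) : Set (List E) :=
  {l | l.length = n ∧ (∀ v ∈ l, v ∈ K) ∧ ∀ v ∈ l, ∀ w ∈ l, dist v w ≤ d}

/-- Subdivision shrinks the mesh by a factor depending only on the dimension and stays inside
every convex set. Applying the inductive hypothesis to the intersection of `K` with a ball around
the barycenter controls the distances from the new vertex. -/
theorem sd_mem_on_small {N : ℕ} {n : ℕ} (hn : n ≤ N) {d : ℝ} (hd : 0 ≤ d) {K : Set E}
    (hK : Convex ℝ K) {l : List E} (hl : l ∈ small n d K) :
    sd n (simplex l) ∈ on (small n ((1 - (N : ℝ)⁻¹) * d) K) := by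
  induction n generalizing K l with
  | zero =>
    obtain ⟨h, -, -⟩ := hl
    obtain rfl := List.length_eq_zero_iff.1 h
    exact simplex_mem_on (by simp [small])
  | succ n ih =>
    obtain ⟨h1, h2, h3⟩ := hl
    have hN : (0 : ℝ) ≤ 1 - (N : ℝ)⁻¹ := by
      have : (1 : ℝ) ≤ N := by exact_mod_cast (by omega : 1 ≤ N)
      linarith [inv_le_one_of_one_le₀ this]
    have hr : 1 - (l.length : ℝ)⁻¹ ≤ 1 - (N : ℝ)⁻¹ := by
      have : (0 : ℝ) < l.length := by rw [h1]; positivity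
      have : (l.length : ℝ) ≤ N := by rw [h1]; exact_mod_cast hn
      gcongr
    have hb : bary l ∈ K := bary_mem hK (by rintro rfl; simp at h1) h2
    have hball : ∀ v ∈ l, v ∈ Metric.closedBall (bary l) ((1 - (N : ℝ)⁻¹) * d) := fun v hv =>
      (dist_bary_le hv fun w hw => h3 w hw v hv).trans (by gcongr)
    rw [sd_simplex]
    refine map_mem_of_mem_on (φ := cone (bary l)) (fun l' hl' => ?_)
      (map_mem_of_mem_on (fun l' hl' => ih (by omega)
        (hK.inter (convex_closedBall (bary l) ((1 - (N : ℝ)⁻¹) * d))) (l := l')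
        ⟨by have := hl'.1; omega, fun v hv => ?_, fun v hv w hw => ?_⟩) (faces_mem_on l))
    · rw [cone_simplex]
      refine simplex_mem_on ⟨by simp [hl'.1], ?_, ?_⟩
      · simpa using ⟨hb, fun v hv => (hl'.2.1 v hv).1⟩
      · intro v hv w hw
        rcases List.mem_cons.1 hv with rfl | hv <;> rcases List.mem_cons.1 hw with rfl | hw
        · rw [dist_self]; positivity
        · rw [dist_comm]; exact (hl'.2.1 w hw).2
        · exact (hl'.2.1 v hv).2
        · exact hl'.2.2 v hv w hw
    · exact ⟨h2 v (hl'.2.subset hv), hball v (hl'.2.subset hv)⟩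
    · exact h3 v (hl'.2.subset hv) w (hl'.2.subset hw)

end Subdivision

end ListChain

/-! ### Fan's alternation functional -/

namespace ListChain

/-- `alt s l` is `1` if the signs in `l` alternate and begin with `s`, and `0` otherwise. Both
values of `s` give `1` on the empty list. -/
def alt : Bool → List Bool → ZMod 2
  | _, [] => 1
  | s, x :: l => if x = s then alt (!s) l else 0

theorem alt_map_not (s : Bool) (l : List Bool) : alt s (l.map (!·)) = alt (!s) l := by
  induction l generalizing s with
  | nil => rfl
  | cons x l ih => cases s <;> cases x <;> simp [alt, ih]

/-- The number of faces of a list of signs that alternate and begin with `s` has the same parity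
as the number of ways in which the whole list alternates. -/
theorem lift_alt_faces (s : Bool) (l : List Bool) :
    lift (alt s) (faces l) = alt true l + alt false l := by
  induction l generalizing s with
  | nil => simp [faces, alt]; rfl
  | cons x l ih =>
    have h : lift (fun l => alt s (x :: l)) (faces l)
        = if x = s then lift (alt (!s)) (faces l) else 0 := by
      split_ifs with hx
      · simp [alt, hx]
      · have : (fun l => alt s (x :: l)) = 0 := funext fun l => by simp [alt, hx]
        rw [this]; simp [lift]
    rw [faces, map_add, lift_cone, lift_simplex, h]
    have h2 : ∀ a : ZMod 2, a + a = 0 := CharTwo.add_self_eq_zero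
    have h3 : ∀ a b : ZMod 2, a + (a + b) = b := fun a b => by rw [← add_assoc, h2, zero_add]
    have h4 : ∀ a b : ZMod 2, a + (b + a) = b := fun a b => by rw [add_comm b, h3]
    cases s <;> cases x <;> simp [alt, ih, h3, h4]

/-- A sum over faces of a symmetric function of lists is symmetric. -/
theorem lift_faces_perm {X M : Type*} [AddCommGroup M] [Module (ZMod 2) M] {F : List X → M}
    (hF : ∀ l l', l.Perm l' → F l = F l') {l l' : List X} (h : l.Perm l') :
    lift F (faces l) = lift F (faces l') := by
  induction h generalizing F with
  | nil => rfl
  | cons x h ih =>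
    simp only [faces, map_add, lift_simplex, lift_cone]
    rw [hF _ _ h, ih fun l l' h' => hF _ _ (h'.cons x)]
  | swap x y l =>
    simp only [faces, map_add, lift_simplex, lift_cone, cone_simplex]
    have : (fun l => F (y :: x :: l)) = fun l => F (x :: y :: l) :=
      funext fun l => hF _ _ (List.Perm.swap _ _ _)
    rw [this]
    abel
  | trans _ _ ih1 ih2 => exact (ih1 hF).trans (ih2 hF)

variable {n : ℕ}

/-- A label is an absolute value below `n` together with a sign; labels are ordered by
absolute value first. -/
abbrev Label (n : ℕ) : Type := Fin n ×ₗ Bool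

/-- The absolute value of a label. -/
def Label.abs (a : Label n) : Fin n := (ofLex a).1

/-- The sign of a label. -/
def Label.sign (a : Label n) : Bool := (ofLex a).2

/-- The opposite label. -/
def Label.flip (a : Label n) : Label n := toLex (a.abs, !a.sign)

@[simp] theorem Label.sign_flip (a : Label n) : a.flip.sign = !a.sign := rfl

@[simp] theorem Label.abs_flip (a : Label n) : a.flip.abs = a.abs := rfl

theorem Label.le_iff {a b : Label n} : a ≤ b ↔ a.abs < b.abs ∨ a.abs = b.abs ∧ a.sign ≤ b.sign :=
  Prod.Lex.le_iff

theorem Label.eq_of {a b : Label n} (h : a.abs = b.abs) (h' : a.sign = b.sign) : a = b := by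
  have : ofLex a = ofLex b := Prod.ext h h'
  exact this

/-- Fan's functional: it detects the lists of labels that, once sorted, have alternating signs
beginning with `s`. -/
def fan (s : Bool) (l : List (Label n)) : ZMod 2 :=
  alt s ((l.insertionSort (· ≤ ·)).map Label.sign)

theorem fan_perm (s : Bool) {l l' : List (Label n)} (h : l.Perm l') : fan s l = fan s l' := by
  have : l.insertionSort (· ≤ ·) = l'.insertionSort (· ≤ ·) :=
    List.Perm.eq_of_pairwise' (r := (· ≤ ·)) (List.pairwise_insertionSort _ _)
      (List.pairwise_insertionSort _ _)
      ((List.perm_insertionSort _ l).trans (h.trans (List.perm_insertionSort _ l').symm))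
  rw [fan, fan, this]

theorem fan_of_sorted (s : Bool) {l : List (Label n)} (h : l.Pairwise (· ≤ ·)) :
    fan s l = alt s (l.map Label.sign) := by
  rw [fan, List.Pairwise.insertionSort_eq h]

/-- The coboundary formula for Fan's functional. -/
theorem lift_fan_faces (s : Bool) (l : List (Label n)) :
    lift (fan s) (faces l) = fan true l + fan false l := by
  set l' := l.insertionSort (· ≤ ·) with hl'
  have hp : l.Perm l' := (List.perm_insertionSort _ l).symm
  have hs : l'.Pairwise (· ≤ ·) := List.pairwise_insertionSort _ _
  rw [lift_faces_perm (fun _ _ => fan_perm s) hp, fan_perm true hp, fan_perm false hp,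
    fan_of_sorted _ hs, fan_of_sorted _ hs, ← lift_alt_faces s, ← push_faces, lift_push]
  refine eq_of_mem_on (fun m hm => ?_) (faces_mem_on l')
  rw [lift_simplex, lift_simplex, fan_of_sorted _ (hs.sublist hm.2)]

/-- No two entries of the list are opposite labels. -/
def NoOpposite (l : List (Label n)) : Prop := ∀ a ∈ l, ∀ b ∈ l, a ≠ b.flip

theorem fan_map_flip (s : Bool) {l : List (Label n)} (h : NoOpposite l) :
    fan s (l.map Label.flip) = fan (!s) l := by
  set l' := l.insertionSort (· ≤ ·) with hl'
  have hp : l.Perm l' := (List.perm_insertionSort _ l).symm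
  have hs : l'.Pairwise (· ≤ ·) := List.pairwise_insertionSort _ _
  have hs' : (l'.map Label.flip).Pairwise (· ≤ ·) := by
    rw [List.pairwise_map]
    refine hs.imp_of_mem fun {a b} ha hb hab => ?_
    rw [Label.le_iff] at hab ⊢
    rcases hab with hab | ⟨h1, -⟩
    · exact Or.inl hab
    · refine Or.inr ⟨h1, ?_⟩
      have h2 : a.sign = b.sign := by
        by_contra h2
        refine h a (hp.mem_iff.2 ha) b (hp.mem_iff.2 hb) (Label.eq_of h1 ?_)
        rw [Label.sign_flip]
        revert h2; cases a.sign <;> cases b.sign <;> simp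
      simp [h2]
  rw [fan_perm s (hp.map _), fan_perm _ hp, fan_of_sorted _ hs, fan_of_sorted _ hs',
    ← alt_map_not]
  simp [Function.comp_def]

theorem pairwise_abs_lt_of_alt_ne_zero (s : Bool) {l : List (Label n)}
    (hs : l.Pairwise (· ≤ ·)) (h : NoOpposite l) (ha : alt s (l.map Label.sign) ≠ 0) :
    (l.map Label.abs).Pairwise (· < ·) := by
  rw [← List.isChain_iff_pairwise]
  induction l generalizing s with
  | nil => simp
  | cons a l ih =>
    have hsa : a.sign = s := by
      by_contra hne
      simp [alt, hne] at ha
    have ha' : alt (!s) (l.map Label.sign) ≠ 0 := by simpa [alt, hsa] using ha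
    have := ih (!s) hs.of_cons
      (fun x hx y hy => h x (List.mem_cons_of_mem _ hx) y (List.mem_cons_of_mem _ hy)) ha'
    cases l with
    | nil => simp
    | cons b l =>
      have hsb : b.sign = !s := by
        by_contra hne
        simp [alt, hne] at ha'
      rw [List.map_cons, List.map_cons, List.isChain_cons_cons]
      refine ⟨?_, by simpa using this⟩
      have hab : a ≤ b := (List.pairwise_cons.1 hs).1 b List.mem_cons_self
      rcases Label.le_iff.1 hab with hlt | ⟨heq, -⟩
      · exact hlt
      · exact absurd (Label.eq_of (b := b.flip) heq (by simp [hsa, hsb]))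
          (h a List.mem_cons_self b (by simp))

theorem fan_eq_zero (s : Bool) {l : List (Label n)} (h : NoOpposite l) (hl : n < l.length) :
    fan s l = 0 := by
  by_contra hne
  have hp := List.perm_insertionSort (· ≤ ·) l
  have h1 := pairwise_abs_lt_of_alt_ne_zero s (List.pairwise_insertionSort _ l)
    (fun a ha b hb => h a (hp.mem_iff.1 ha) b (hp.mem_iff.1 hb)) hne
  have h2 := List.Nodup.length_le_card (h1.imp fun {a b} hab => hab.ne)
  simp at h2
  omega

/-! ### Tucker's lemma and the Borsuk–Ulam theorem -/

variable {N : ℕ}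

/-- The unit sphere of the `ℓ¹` norm, which is the boundary of the cross-polytope. -/
def crossSphere (N : ℕ) : Set (Fin N → ℝ) := {x | ∑ i, |x i| = 1}

/-- The facet of the cross-polytope in the orthant of the sign vector `ε`. -/
def facet (ε : Fin N → ℝ) : Set (Fin N → ℝ) := {x | (∀ i, 0 ≤ ε i * x i) ∧ ∑ i, ε i * x i = 1}

/-- The sign vectors. -/
def signVectors (N : ℕ) : Set (Fin N → ℝ) := {ε | ∀ i, |ε i| = 1}

theorem convex_facet (ε : Fin N → ℝ) : Convex ℝ (facet ε) := by
  intro x hx y hy a b ha hb hab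
  have e : ∀ i, ε i * (a • x + b • y) i = a * (ε i * x i) + b * (ε i * y i) := fun i => by
    simp only [Pi.add_apply, Pi.smul_apply, smul_eq_mul]; ring
  refine ⟨fun i => ?_, ?_⟩
  · rw [e]
    have := hx.1 i
    have := hy.1 i
    positivity
  · simp only [e]
    rw [Finset.sum_add_distrib, ← Finset.mul_sum, ← Finset.mul_sum, hx.2, hy.2]
    linarith

theorem facet_subset {ε : Fin N → ℝ} (hε : ε ∈ signVectors N) : facet ε ⊆ crossSphere N := by
  intro x hx
  rw [crossSphere, Set.mem_ofPred_eq, ← hx.2]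
  refine Finset.sum_congr rfl fun i _ => ?_
  rw [← abs_of_nonneg (hx.1 i), abs_mul, hε i, one_mul]

theorem abs_le_of_mem_crossSphere {x : Fin N → ℝ} (hx : x ∈ crossSphere N) (i : Fin N) :
    |x i| ≤ 1 := by
  have h : ∑ i, |x i| = 1 := hx
  rw [← h]
  exact Finset.single_le_sum (f := fun i => |x i|) (fun i _ => abs_nonneg _) (Finset.mem_univ i)

/-- The `k`-th unit vector of `ℝ^N`, which is zero if `N ≤ k`. -/
def unitVec (N k : ℕ) : Fin N → ℝ := fun i => if (i : ℕ) = k then 1 else 0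

/-- The fundamental cycle of the boundary of the `k`-dimensional cross-polytope, as an iterated
suspension of the empty list. -/
noncomputable def sphere (N : ℕ) : ℕ → ListChain (Fin N → ℝ)
  | 0 => simplex []
  | k + 1 => cone (unitVec N k) (sphere N k) + cone (-unitVec N k) (sphere N k)

theorem push_neg_sphere (k : ℕ) : push (fun x => -x) (sphere N k) = sphere N k := by
  induction k with
  | zero => simp [sphere]
  | succ k ih => simp [sphere, push_cone, ih, add_comm]

theorem bdry_sphere (k : ℕ) : bdry (sphere N k) = 0 := by
  induction k with
  | zero => simp [sphere, faces]
  | succ k ih => simp [sphere, bdry_cone, ih, add_self]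

/-- The lists that lie in one facet and have mutual distances at most `d`. -/
def facetSmall (N k : ℕ) (d : ℝ) : Set (List (Fin N → ℝ)) :=
  ⋃ ε ∈ signVectors N, small k d (facet ε)

theorem sd_mem_on_facetSmall {k : ℕ} (hk : k ≤ N) {d : ℝ} (hd : 0 ≤ d)
    {c : ListChain (Fin N → ℝ)} (hc : c ∈ on (facetSmall N k d)) :
    sd k c ∈ on (facetSmall N k ((1 - (N : ℝ)⁻¹) * d)) := by
  refine map_mem_of_mem_on (fun l hl => ?_) hc
  simp only [facetSmall, Set.mem_iUnion] at hl
  obtain ⟨ε, hε, hl⟩ := hl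
  exact on_mono (Set.subset_biUnion_of_mem (u := fun ε => small k _ (facet ε)) hε)
    (sd_mem_on_small hk hd (convex_facet ε) hl)

theorem iterate_sd_mem_on_facetSmall {k : ℕ} (hk : k ≤ N) (hN : N ≠ 0) (m : ℕ) {d : ℝ}
    (hd : 0 ≤ d) {c : ListChain (Fin N → ℝ)} (hc : c ∈ on (facetSmall N k d)) :
    (sd k)^[m] c ∈ on (facetSmall N k ((1 - (N : ℝ)⁻¹) ^ m * d)) := by
  have hr : (0 : ℝ) ≤ 1 - (N : ℝ)⁻¹ := by
    have : (1 : ℝ) ≤ N := by exact_mod_cast Nat.one_le_iff_ne_zero.2 hN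
    linarith [inv_le_one_of_one_le₀ this]
  induction m with
  | zero => simpa using hc
  | succ m ih =>
    rw [Function.iterate_succ_apply', pow_succ', mul_assoc]
    exact sd_mem_on_facetSmall hk (by positivity) ih

/-- The lists of `k` points of a facet whose coordinates vanish from the `k`-th one on. -/
def flagLists (N k : ℕ) : Set (List (Fin N → ℝ)) :=
  {l | l.length = k ∧ ∃ ε ∈ signVectors N, ∀ v ∈ l, v ∈ facet ε ∧ ∀ i : Fin N, k ≤ i → v i = 0}

theorem cone_mem_on_flagLists {k : ℕ} (hk : k + 1 ≤ N) {s : ℝ} (hs : |s| = 1)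
    {c : ListChain (Fin N → ℝ)} (hc : c ∈ on (flagLists N k)) :
    cone (s • unitVec N k) c ∈ on (flagLists N (k + 1)) := by
  refine map_mem_of_mem_on (fun l hl => ?_) hc
  obtain ⟨h1, ε, hε, h2⟩ := hl
  rw [cone_simplex]
  have hss : s * s = 1 := by rw [← abs_mul_abs_self, hs, one_mul]
  refine simplex_mem_on ⟨by simp [h1], Function.update ε ⟨k, hk⟩ s, fun i => ?_, ?_⟩
  · by_cases hi : i = ⟨k, hk⟩
    · subst hi; simpa using hs
    · simpa [hi] using hε i
  · intro v hv
    rcases List.mem_cons.1 hv with rfl | hv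
    · have e : ∀ i : Fin N, Function.update ε ⟨k, hk⟩ s i * (s • unitVec N k) i
          = if i = ⟨k, hk⟩ then 1 else 0 := fun i => by
        by_cases hi : i = ⟨k, hk⟩
        · subst hi; simp [unitVec, hss]
        · have : (i : ℕ) ≠ k := fun h => hi (Fin.ext h)
          simp [unitVec, hi, this]
      refine ⟨⟨fun i => ?_, ?_⟩, fun i hi => ?_⟩
      · rw [e]; split_ifs <;> norm_num
      · simp only [e]; simp
      · have : (i : ℕ) ≠ k := by omega
        simp [unitVec, this]
    · obtain ⟨⟨h3, h4⟩, h5⟩ := h2 v hv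
      have e : ∀ i : Fin N, Function.update ε ⟨k, hk⟩ s i * v i = ε i * v i := fun i => by
        by_cases hi : i = ⟨k, hk⟩
        · subst hi; simp [h5 ⟨k, hk⟩ le_rfl]
        · simp [hi]
      exact ⟨⟨fun i => by rw [e]; exact h3 i, by simpa only [e] using h4⟩,
        fun i hi => h5 i (by omega)⟩

theorem sphere_mem_on {k : ℕ} (hk : k ≤ N) : sphere N k ∈ on (flagLists N k) := by
  induction k with
  | zero => exact simplex_mem_on ⟨rfl, fun _ => 1, fun i => by simp, by simp⟩
  | succ k ih =>
    have h1 := cone_mem_on_flagLists hk (s := 1) (by simp) (ih (by omega))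
    have h2 := cone_mem_on_flagLists hk (s := -1) (by simp) (ih (by omega))
    rw [one_smul] at h1
    rw [neg_one_smul] at h2
    exact add_mem h1 h2

theorem dist_le_two_of_mem_crossSphere {x y : Fin N → ℝ} (hx : x ∈ crossSphere N)
    (hy : y ∈ crossSphere N) : dist x y ≤ 2 := by
  refine (dist_pi_le_iff (by norm_num)).2 fun i => ?_
  have h1 := abs_le.1 (abs_le_of_mem_crossSphere hx i)
  have h2 := abs_le.1 (abs_le_of_mem_crossSphere hy i)
  rw [Real.dist_eq, abs_le]
  constructor <;> linarith [h1.1, h1.2, h2.1, h2.2]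

theorem flagLists_subset_facetSmall (k : ℕ) : flagLists N k ⊆ facetSmall N k 2 := by
  rintro l ⟨h1, ε, hε, h2⟩
  simp only [facetSmall, Set.mem_iUnion]
  exact ⟨ε, hε, h1, fun v hv => (h2 v hv).1, fun v hv w hw =>
    dist_le_two_of_mem_crossSphere (facet_subset hε (h2 v hv).1) (facet_subset hε (h2 w hw).1)⟩

theorem sphere_mem_on_facetSmall {k : ℕ} (hk : k ≤ N) :
    sphere N k ∈ on (facetSmall N k 2) :=
  on_mono (flagLists_subset_facetSmall k) (sphere_mem_on hk)

theorem cone_sphere_mem_on_facetSmall {k : ℕ} (hk : k + 1 ≤ N) :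
    cone (unitVec N k) (sphere N k) ∈ on (facetSmall N (k + 1) 2) := by
  have h := cone_mem_on_flagLists hk (s := 1) (by simp) (sphere_mem_on (by omega))
  rw [one_smul] at h
  exact on_mono (flagLists_subset_facetSmall _) h

theorem iterate_sd_push_neg {k m : ℕ} (c : ListChain (Fin N → ℝ)) :
    (sd k)^[m] (push (fun x => -x) c) = push (fun x => -x) ((sd k)^[m] c) := by
  induction m with
  | zero => rfl
  | succ m ih => rw [Function.iterate_succ_apply', ih, sd_push_neg, Function.iterate_succ_apply']

theorem length_of_mem_facetSmall {k : ℕ} {d : ℝ} {l : List (Fin N → ℝ)}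
    (h : l ∈ facetSmall N k d) : l.length = k := by
  simp only [facetSmall, Set.mem_iUnion] at h
  exact h.choose_spec.choose_spec.1

theorem bdry_iterate_sd {k m : ℕ} (hN : N ≠ 0) (hk : k + 1 ≤ N) {c : ListChain (Fin N → ℝ)}
    (hc : c ∈ on (facetSmall N (k + 1) 2)) :
    bdry ((sd (k + 1))^[m] c) = (sd k)^[m] (bdry c) := by
  induction m with
  | zero => rfl
  | succ m ih =>
    rw [Function.iterate_succ_apply', Function.iterate_succ_apply', ← ih]
    exact bdry_sd k (on_mono (fun l hl => length_of_mem_facetSmall hl)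
      (iterate_sd_mem_on_facetSmall hk hN m (by norm_num) hc))

/-- Tucker's lemma for the `n`-sphere: an antipodal labelling by `n` labels and their opposites
takes opposite values at two points that are arbitrarily close. -/
theorem exists_opposite_labels (lab : (Fin (n + 1) → ℝ) → Label n)
    (hlab : ∀ x ∈ crossSphere (n + 1), lab (-x) = (lab x).flip) {d : ℝ} (hd : 0 < d) :
    ∃ x ∈ crossSphere (n + 1), ∃ y ∈ crossSphere (n + 1), dist x y ≤ d ∧ lab x = (lab y).flip := by
  by_contra! hno
  have hN : n + 1 ≠ 0 := by omega
  -- Subdivide until the mesh is at most `d`.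
  obtain ⟨m, hm⟩ : ∃ m : ℕ, (1 - ((n + 1 : ℕ) : ℝ)⁻¹) ^ m * 2 ≤ d := by
    have hpos : (0 : ℝ) < ((n + 1 : ℕ) : ℝ)⁻¹ := by positivity
    obtain ⟨m, hm⟩ := exists_pow_lt_of_lt_one (half_pos hd)
      (show 1 - ((n + 1 : ℕ) : ℝ)⁻¹ < 1 by linarith)
    exact ⟨m, by linarith⟩
  have hgood : ∀ (k : ℕ) (l : List (Fin (n + 1) → ℝ)),
      l ∈ facetSmall (n + 1) k ((1 - ((n + 1 : ℕ) : ℝ)⁻¹) ^ m * 2) →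
      NoOpposite (l.map lab) ∧ fan true ((l.map fun x => -x).map lab) = fan false (l.map lab) := by
    intro k l hl
    simp only [facetSmall, Set.mem_iUnion] at hl
    obtain ⟨ε, hε, h1, h2, h3⟩ := hl
    have hop : NoOpposite (l.map lab) := by
      intro a ha b hb
      obtain ⟨v, hv, rfl⟩ := List.mem_map.1 ha
      obtain ⟨w, hw, rfl⟩ := List.mem_map.1 hb
      exact hno v (facet_subset hε (h2 v hv)) w (facet_subset hε (h2 w hw))
        ((h3 v hv w hw).trans hm)
    refine ⟨hop, ?_⟩
    have e : (l.map fun x => -x).map lab = (l.map lab).map Label.flip := by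
      rw [List.map_map, List.map_map]
      exact List.map_congr_left fun v hv => hlab v (facet_subset hε (h2 v hv))
    rw [e, fan_map_flip _ hop]
    rfl
  set Φ : Bool → ListChain (Fin (n + 1) → ℝ) →ₗ[ZMod 2] ZMod 2 :=
    fun s => lift fun l => fan s (l.map lab) with hΦ
  have hbdry : ∀ c, Φ true (bdry c) = Φ true c + Φ false c := by
    intro c
    have : Φ true ∘ₗ bdry = Φ true + Φ false := hom_ext fun l => by
      simp only [hΦ, LinearMap.comp_apply, bdry_simplex, LinearMap.add_apply, lift_simplex]
      rw [← lift_push, push_faces, lift_fan_faces]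
    exact LinearMap.congr_fun this c
  -- The functional takes the value one on every subdivided sphere, by induction on dimension.
  have hone : ∀ k ≤ n + 1, Φ true ((sd k)^[m] (sphere (n + 1) k)) = 1 := by
    intro k
    induction k with
    | zero =>
      intro _
      have : (sd 0)^[m] (sphere (n + 1) 0) = sphere (n + 1) 0 := by
        simp [sd]
      rw [this]
      simp [hΦ, sphere, fan, alt]
    | succ k ih =>
      intro hk
      have hc := cone_sphere_mem_on_facetSmall hk
      set c := cone (unitVec (n + 1) k) (sphere (n + 1) k) with hcdef
      have hz : sphere (n + 1) (k + 1) = c + push (fun x => -x) c := by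
        rw [hcdef, push_cone, push_neg_sphere]; rfl
      have hadd : ∀ a b : ListChain (Fin (n + 1) → ℝ),
          (sd (k + 1))^[m] (a + b) = (sd (k + 1))^[m] a + (sd (k + 1))^[m] b :=
        fun a b => iterate_map_add (sd (k + 1)) m a b
      have hflip : Φ true (push (fun x => -x) ((sd (k + 1))^[m] c))
          = Φ false ((sd (k + 1))^[m] c) := by
        have := eq_of_mem_on (φ := Φ true ∘ₗ push (fun x => -x)) (ψ := Φ false)
          (fun l hl => by
            simp only [hΦ, LinearMap.comp_apply, push_simplex, lift_simplex]
            exact (hgood _ l hl).2)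
          (iterate_sd_mem_on_facetSmall hk hN m (by norm_num) hc)
        exact this
      have hbc : bdry c = sphere (n + 1) k := by
        rw [hcdef, bdry_cone, bdry_sphere, map_zero, add_zero]
      rw [hz, hadd, iterate_sd_push_neg, map_add, hflip, ← hbdry, bdry_iterate_sd hN hk hc, hbc]
      exact ih (by omega)
  have hzero : Φ true ((sd (n + 1))^[m] (sphere (n + 1) (n + 1))) = 0 := by
    have := eq_of_mem_on (φ := Φ true) (ψ := 0)
      (fun l hl => by
        simp only [hΦ, lift_simplex, LinearMap.zero_apply]
        exact fan_eq_zero _ (hgood _ l hl).1 (by simp [length_of_mem_facetSmall hl]))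
      (iterate_sd_mem_on_facetSmall le_rfl hN m (by norm_num) (sphere_mem_on_facetSmall le_rfl))
    exact this
  rw [hone (n + 1) le_rfl] at hzero
  exact one_ne_zero hzero

theorem isCompact_crossSphere : IsCompact (crossSphere N) := by
  refine Metric.isCompact_of_isClosed_isBounded ?_ ?_
  · exact isClosed_eq (by fun_prop) continuous_const
  · exact Metric.isBounded_iff.2 ⟨2, fun x hx y hy => dist_le_two_of_mem_crossSphere hx hy⟩

/-- **Borsuk–Ulam theorem**: a continuous odd map from the `n`-sphere to `ℝⁿ` has a zero. -/
theorem exists_zero_of_odd {n : ℕ} {f : (Fin (n + 1) → ℝ) → Fin n → ℝ} (hf : Continuous f)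
    (hodd : ∀ x ∈ crossSphere (n + 1), f (-x) = -f x) : ∃ x ∈ crossSphere (n + 1), f x = 0 := by
  by_contra! hne
  obtain ⟨x₀, hx₀⟩ : (crossSphere (n + 1)).Nonempty :=
    ⟨Pi.single 0 1, by simp [crossSphere, Pi.single_apply, abs_ite]⟩
  obtain ⟨x₁, hx₁, hmin⟩ := isCompact_crossSphere.exists_isMinOn ⟨x₀, hx₀⟩ hf.norm.continuousOn
  set δ := ‖f x₁‖ with hδ
  have hδ0 : 0 < δ := norm_pos_iff.2 (hne x₁ hx₁)
  have hbig : ∀ x ∈ crossSphere (n + 1), ∃ i, δ ≤ |f x i| := by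
    intro x hx
    by_contra! hlt
    exact absurd ((pi_norm_lt_iff hδ0).2 hlt) (not_lt.2 (hmin hx))
  obtain ⟨i₀, -⟩ := hbig x₀ hx₀
  have : Nonempty (Fin n) := ⟨i₀⟩
  -- The label of `x` is a large coordinate of `f x`, chosen by absolute values alone, with its sign.
  let lab : (Fin (n + 1) → ℝ) → Label n := fun x =>
    toLex (Classical.epsilon fun i => δ ≤ |f x i|,
      decide (0 < f x (Classical.epsilon fun i => δ ≤ |f x i|)))
  have habs : ∀ x ∈ crossSphere (n + 1), δ ≤ |f x (lab x).abs| := fun x hx =>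
    Classical.epsilon_spec (hbig x hx)
  have hsign : ∀ x, (lab x).sign = decide (0 < f x (lab x).abs) := fun x => rfl
  have hflip : ∀ x ∈ crossSphere (n + 1), lab (-x) = (lab x).flip := by
    intro x hx
    have h1 : (lab (-x)).abs = (lab x).abs := by
      simp only [lab, Label.abs, ofLex_toLex, hodd x hx, Pi.neg_apply, abs_neg]
    refine Label.eq_of h1 ?_
    rw [Label.sign_flip, hsign, hsign, h1, hodd x hx, Pi.neg_apply]
    have := habs x hx
    have hne : f x (lab x).abs ≠ 0 := by
      intro h; rw [h, abs_zero] at this; linarith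
    rcases lt_or_gt_of_ne hne with h | h
    · simp [h, h.le]
    · simp [h, h.le]
  obtain ⟨η, hη, huc⟩ := Metric.uniformContinuousOn_iff.1
    (isCompact_crossSphere.uniformContinuousOn_of_continuous hf.continuousOn) δ hδ0
  obtain ⟨x, hx, y, hy, hxy, hl⟩ := exists_opposite_labels lab hflip (half_pos hη)
  have hd := (dist_le_pi_dist (f x) (f y) (lab x).abs).trans_lt (huc x hx y hy (by linarith))
  have e : (lab x).abs = (lab y).abs := by rw [hl]; rfl
  have h1 := habs x hx
  have h2 := habs y hy
  have h3 : (lab x).sign = !(lab y).sign := by rw [hl]; rfl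
  rw [hsign, hsign, ← e] at h3
  rw [← e] at h2
  rw [Real.dist_eq] at hd
  by_cases h4 : 0 < f x (lab x).abs
  · have h5 : ¬ 0 < f y (lab x).abs := by simpa [h4] using h3
    rw [abs_of_pos h4] at h1
    rw [abs_of_nonpos (not_lt.1 h5)] at h2
    linarith [(abs_lt.1 hd).2]
  · have h5 : 0 < f y (lab x).abs := by simpa [h4] using h3
    rw [abs_of_nonpos (not_lt.1 h4)] at h1
    rw [abs_of_pos h5] at h2
    linarith [(abs_lt.1 hd).1]

end ListChain

/-! ### Cutting a curve into balanced pieces -/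

section Cuts

open ListChain

variable {n : ℕ}

/-- The `k`-th cut point of the partition of `[0, 1]` into intervals of lengths `|x i|`. -/
def cut (x : Fin (n + 1) → ℝ) (k : ℕ) : ℝ := ∑ i : Fin (n + 1), if (i : ℕ) < k then |x i| else 0

theorem cut_zero (x : Fin (n + 1) → ℝ) : cut x 0 = 0 := by simp [cut]

theorem cut_last (x : Fin (n + 1) → ℝ) : cut x (n + 1) = ∑ i, |x i| := by
  simp only [cut, Fin.is_lt, if_true]

theorem cut_mono (x : Fin (n + 1) → ℝ) : Monotone (cut x) := by
  intro j k hjk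
  refine Finset.sum_le_sum fun i _ => ?_
  split_ifs with h1 h2
  · exact le_rfl
  · omega
  · positivity
  · exact le_rfl

theorem cut_succ (x : Fin (n + 1) → ℝ) (j : Fin (n + 1)) :
    cut x (j + 1) = cut x j + |x j| := by
  have : ∀ i : Fin (n + 1), (if (i : ℕ) < j + 1 then |x i| else 0)
      = (if (i : ℕ) < j then |x i| else 0) + if i = j then |x i| else 0 := by
    intro i
    rcases lt_trichotomy (i : ℕ) j with h | h | h
    · have : i ≠ j := fun e => by subst e; omega
      simp [h, this, Nat.lt_succ_of_lt h]
    · obtain rfl := Fin.ext h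
      simp
    · have h1 : i ≠ j := fun e => by subst e; omega
      have h2 : ¬ (i : ℕ) < j + 1 := by omega
      have h3 : ¬ (i : ℕ) < j := by omega
      rw [if_neg h1, if_neg h2, if_neg h3, add_zero]
  simp only [cut, this, Finset.sum_add_distrib]
  simp

theorem continuous_cut (k : ℕ) : Continuous fun x : Fin (n + 1) → ℝ => cut x k := by
  refine continuous_finsetSum _ fun i _ => ?_
  split_ifs
  · fun_prop
  · fun_prop

theorem cut_mem_Icc {x : Fin (n + 1) → ℝ} (hx : x ∈ crossSphere (n + 1)) {k : ℕ}
    (hk : k ≤ n + 1) : cut x k ∈ Set.Icc (0 : ℝ) 1 := by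
  constructor
  · rw [← cut_zero x]; exact cut_mono x (Nat.zero_le k)
  · have : ∑ i, |x i| = 1 := hx
    rw [← this, ← cut_last x]; exact cut_mono x hk

theorem continuous_sign_smul {X V : Type*} [TopologicalSpace X] [NormedAddCommGroup V]
    [NormedSpace ℝ V] {u : X → ℝ} {D : X → V} (hu : Continuous u) (hD : Continuous D)
    (h : ∀ x, u x = 0 → D x = 0) : Continuous fun x => Real.sign (u x) • D x := by
  rw [continuous_iff_continuousAt]
  intro x
  rcases lt_trichotomy (u x) 0 with hx | hx | hx
  · refine (hD.neg.continuousAt (x := x)).congr ?_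
    filter_upwards [hu.continuousAt.eventually_lt_const hx] with y hy
    simp [Real.sign_of_neg hy]
  · have h0 : Real.sign (u x) • D x = 0 := by simp [hx]
    rw [ContinuousAt, h0]
    refine squeeze_zero_norm (a := fun y => ‖D y‖) (fun y => ?_) ?_
    · rw [norm_smul]
      have : ‖Real.sign (u y)‖ ≤ 1 := by
        rcases Real.sign_apply_eq (u y) with h | h | h <;> simp [h]
      exact mul_le_of_le_one_left (norm_nonneg _) this
    · have := (hD.norm.continuousAt (x := x)).tendsto
      rwa [h x hx, norm_zero] at this
  · refine (hD.continuousAt (x := x)).congr ?_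
    filter_upwards [hu.continuousAt.eventually_const_lt hx] with y hy
    simp [Real.sign_of_pos hy]

/-- The increment of the curve `h` over the `j`-th interval of the partition given by `x`. -/
def increment (h : ℝ → Fin n → ℝ) (x : Fin (n + 1) → ℝ) (j : Fin (n + 1)) : Fin n → ℝ :=
  h (cut x (j + 1)) - h (cut x j)

theorem increment_eq_zero (h : ℝ → Fin n → ℝ) {x : Fin (n + 1) → ℝ} {j : Fin (n + 1)}
    (hj : x j = 0) : increment h x j = 0 := by
  simp [increment, cut_succ, hj]

/-- A continuous curve in `ℝⁿ` can be cut at `n` points so that the increments over the pieces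
have vanishing signed sum; the Borsuk–Ulam theorem is applied to this sum as a function of the
signed lengths of the pieces. -/
theorem exists_signed_sum_increment_eq_zero {h : ℝ → Fin n → ℝ} (hh : Continuous h) :
    ∃ x ∈ crossSphere (n + 1), ∑ j, Real.sign (x j) • increment h x j = 0 := by
  refine exists_zero_of_odd (f := fun x => ∑ j, Real.sign (x j) • increment h x j) ?_ ?_
  · refine continuous_finsetSum _ fun j _ => continuous_sign_smul (by fun_prop) ?_
      fun x hx => increment_eq_zero h hx
    exact (hh.comp (continuous_cut _)).sub (hh.comp (continuous_cut _))
  · intro x _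
    have : ∀ k, cut (-x) k = cut x k := fun k => by simp [cut]
    simp [increment, this, Real.sign_neg]

theorem sum_increment (h : ℝ → Fin n → ℝ) {x : Fin (n + 1) → ℝ} (hx : x ∈ crossSphere (n + 1)) :
    ∑ j, increment h x j = h 1 - h 0 := by
  have h1 : cut x (n + 1) = 1 := (cut_last x).trans hx
  have := Finset.sum_range_sub (fun k => h (cut x k)) (n + 1)
  rw [Finset.sum_range, h1, cut_zero] at this
  exact this

/-- In `ℝ⁴` two non-overlapping, possibly degenerate intervals carry half of the total increment:
of the five pieces, at most two have the rarer sign. -/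
theorem exists_half_increment {h : ℝ → Fin 4 → ℝ} (hh : Continuous h) :
    ∃ a b c d : ℝ, 0 ≤ a ∧ a ≤ b ∧ b ≤ c ∧ c ≤ d ∧ d ≤ 1 ∧
      (2 : ℝ) • (h b - h a + (h d - h c)) = h 1 - h 0 := by
  obtain ⟨x, hx, hsum⟩ := exists_signed_sum_increment_eq_zero hh
  have htot := sum_increment h hx
  have hhalf : ∃ S : Finset (Fin 5), S.card ≤ 2 ∧
      (2 : ℝ) • ∑ j ∈ S, increment h x j = h 1 - h 0 := by
    classical
    set S : Finset (Fin 5) := Finset.univ.filter fun j => x j < 0 with hS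
    have hsplit := Finset.sum_add_sum_compl S (increment h x)
    have hsplit' := Finset.sum_add_sum_compl S fun j => Real.sign (x j) • increment h x j
    have h1 : ∑ j ∈ S, Real.sign (x j) • increment h x j = -∑ j ∈ S, increment h x j := by
      rw [← Finset.sum_neg_distrib]
      refine Finset.sum_congr rfl fun j hj => ?_
      rw [Real.sign_of_neg (Finset.mem_filter.1 hj).2, neg_one_smul]
    have h2 : ∑ j ∈ Sᶜ, Real.sign (x j) • increment h x j = ∑ j ∈ Sᶜ, increment h x j := by
      refine Finset.sum_congr rfl fun j hj => ?_
      have hj' : 0 ≤ x j := by simpa [hS] using hj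
      rcases hj'.eq_or_lt with h0 | h0
      · rw [increment_eq_zero h h0.symm, smul_zero]
      · rw [Real.sign_of_pos h0, one_smul]
    rw [h1, h2, hsum, neg_add_eq_zero] at hsplit'
    rw [htot, ← hsplit'] at hsplit
    have hc := Finset.card_add_card_compl S
    rw [Fintype.card_fin] at hc
    by_cases hcard : S.card ≤ 2
    · exact ⟨S, hcard, by rw [two_smul, hsplit]⟩
    · exact ⟨Sᶜ, by omega, by rw [two_smul, ← hsplit', hsplit]⟩
  obtain ⟨S, hcard, hS⟩ := hhalf
  have hmem : ∀ k ≤ 5, 0 ≤ cut x k ∧ cut x k ≤ 1 := fun k hk => cut_mem_Icc hx hk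
  have hcase : S.card = 0 ∨ S.card = 1 ∨ S.card = 2 := by omega
  rcases hcase with h0 | h0 | h0
  · rw [Finset.card_eq_zero] at h0
    exact ⟨0, 0, 0, 0, le_rfl, le_rfl, le_rfl, le_rfl, zero_le_one, by simpa [h0] using hS⟩
  · obtain ⟨i, rfl⟩ := Finset.card_eq_one.1 h0
    rw [Finset.sum_singleton] at hS
    exact ⟨cut x i, cut x (i + 1), cut x (i + 1), cut x (i + 1), (hmem _ (by omega)).1,
      cut_mono x (by omega), le_rfl, le_rfl, (hmem _ (by omega)).2, by simpa [increment] using hS⟩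
  · obtain ⟨i, j, hij, rfl⟩ := Finset.card_eq_two.1 h0
    rw [Finset.sum_pair hij] at hS
    have key : ∀ i j : Fin 5, i < j →
        (2 : ℝ) • (increment h x i + increment h x j) = h 1 - h 0 →
        ∃ a b c d : ℝ, 0 ≤ a ∧ a ≤ b ∧ b ≤ c ∧ c ≤ d ∧ d ≤ 1 ∧
          (2 : ℝ) • (h b - h a + (h d - h c)) = h 1 - h 0 := fun i j hlt hS =>
      ⟨cut x i, cut x (i + 1), cut x j, cut x (j + 1), (hmem _ (by omega)).1,
        cut_mono x (by omega), cut_mono x (by omega), cut_mono x (by omega),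
        (hmem _ (by omega)).2, hS⟩
    rcases lt_or_gt_of_ne hij with hlt | hlt
    · exact key i j hlt hS
    · exact key j i hlt (by rwa [add_comm])

end Cuts

/-! ### Parallelograms -/

theorem exists_forall_smul_ne (u : E3) : ∃ w : E3, ∀ r : ℝ, w ≠ r • u := by
  by_contra! h
  have h1 : Module.finrank ℝ E3 ≤ 1 := finrank_le_one u fun w => (h w).imp fun r hr => hr.symm
  simp at h1

theorem isParallelogram_of_injective {P : Fin 4 → E3} (hinj : Function.Injective P)
    (h : P 1 - P 0 = P 2 - P 3) : IsParallelogram P := by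
  by_cases hai : AffineIndependent ℝ ![P 0, P 1, P 2]
  · exact Or.inl ⟨hai, h⟩
  · have hcol : Collinear ℝ ({P 0, P 1, P 2} : Set E3) := by
      by_contra hc
      exact hai (affineIndependent_iff_not_collinear_set.2 hc)
    have h01 : P 0 ≠ P 1 := fun e => absurd (hinj e) (by decide)
    obtain ⟨t, ht⟩ : ∃ t : ℝ, P 2 - P 0 = t • (P 1 - P 0) := by
      obtain ⟨v, hv⟩ := (collinear_iff_of_mem (p₀ := P 0) (by simp)).1 hcol
      obtain ⟨r, hr⟩ := hv (P 1) (by simp)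
      obtain ⟨q, hq⟩ := hv (P 2) (by simp)
      have hr' : P 1 - P 0 = r • v := by rw [hr]; simp
      have hq' : P 2 - P 0 = q • v := by rw [hq]; simp
      have hr0 : r ≠ 0 := by
        rintro rfl
        rw [zero_smul, sub_eq_zero] at hr'
        exact h01 hr'.symm
      exact ⟨q / r, by rw [hr', hq', smul_smul, div_mul_cancel₀ _ hr0]⟩
    have h3 : P 3 = P 2 - (P 1 - P 0) := by rw [h]; abel
    refine Or.inr ⟨hinj, ?_, ?_⟩
    · refine (collinear_iff_of_mem (p₀ := P 0) (Set.mem_range_self 0)).2 ⟨P 1 - P 0, ?_⟩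
      rintro _ ⟨i, rfl⟩
      have e2 : P 2 = t • (P 1 - P 0) + P 0 := by rw [← ht]; abel
      fin_cases i
      · exact ⟨0, by simp⟩
      · exact ⟨1, by simp⟩
      · exact ⟨t, e2⟩
      · refine ⟨t - 1, ?_⟩
        change P 3 = (t - 1) • (P 1 - P 0) + P 0
        rw [h3, sub_smul, ← ht, one_smul]
        abel
    · -- Move the vertices `P 2` and `P 3` off the line by the same small vector.
      obtain ⟨w, hw⟩ := exists_forall_smul_ne (P 1 - P 0)
      have hoff : ∀ r : ℝ, r ≠ 0 → AffineIndependent ℝ ![P 0, P 1, P 2 + r • w] := by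
        intro r hk
        rw [affineIndependent_iff_not_collinear_set]
        intro hc
        obtain ⟨v, hv⟩ := (collinear_iff_of_mem (p₀ := P 0) (by simp)).1 hc
        obtain ⟨p, hp⟩ := hv (P 1) (by simp)
        obtain ⟨q, hq⟩ := hv (P 2 + r • w) (by simp)
        have hp' : P 1 - P 0 = p • v := by rw [hp]; simp
        have hp0 : p ≠ 0 := by
          rintro rfl
          rw [zero_smul, sub_eq_zero] at hp'
          exact h01 hp'.symm
        have hv' : v = p⁻¹ • (P 1 - P 0) := by rw [hp', smul_smul, inv_mul_cancel₀ hp0, one_smul]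
        have hq' : r • w = (q * p⁻¹ - t) • (P 1 - P 0) := by
          have e : r • w = (P 2 + r • w - P 0) - (P 2 - P 0) := by abel
          rw [e, ht, sub_smul, mul_smul, ← hv', hq]
          simp
        refine hw (r⁻¹ * (q * p⁻¹ - t)) ?_
        rw [mul_smul, ← hq', smul_smul, inv_mul_cancel₀ hk, one_smul]
      refine ⟨fun k => ![P 0, P 1, P 2 + (1 / ((k : ℝ) + 1)) • w, P 3 + (1 / ((k : ℝ) + 1)) • w],
        fun k => ⟨?_, ?_⟩, ?_⟩
      · have hk : (1 / ((k : ℝ) + 1)) ≠ 0 := by positivity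
        exact hoff _ hk
      · change P 1 - P 0 = (P 2 + (1 / ((k : ℝ) + 1)) • w) - (P 3 + (1 / ((k : ℝ) + 1)) • w)
        rw [h]; abel
      · have hlim : ∀ Q : E3,
            Tendsto (fun k : ℕ => Q + (1 / ((k : ℝ) + 1)) • w) atTop (𝓝 Q) := fun Q => by
          have := (tendsto_one_div_add_atTop_nhds_zero_nat (𝕜 := ℝ)).smul_const w
          simpa using this.const_add Q
        rw [tendsto_pi_nhds]
        intro i
        fin_cases i
        · exact tendsto_const_nhds
        · exact tendsto_const_nhds
        · exact hlim (P 2)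
        · exact hlim (P 3)

/-! ### Parallelograms inscribed in a loop -/

/-- The curve `γ` together with the coordinate `m`, as a curve in `ℝ⁴` defined on the whole line. -/
noncomputable def liftedCurve (γ : unitInterval → E3) (m : ℝ → ℝ) (t : ℝ) : Fin 4 → ℝ :=
  Fin.cons (m t) fun k : Fin 3 => Set.IccExtend zero_le_one γ t k

theorem continuous_liftedCurve {γ : unitInterval → E3} (hγ : Continuous γ) {m : ℝ → ℝ}
    (hm : Continuous m) : Continuous (liftedCurve γ m) := by
  refine continuous_pi fun i => ?_
  refine Fin.cases ?_ (fun k => ?_) i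
  · simpa [liftedCurve] using hm
  · have h1 : Continuous (Set.IccExtend (zero_le_one (α := ℝ)) γ) := hγ.Icc_extend'
    have h2 : Continuous fun t => Set.IccExtend (zero_le_one (α := ℝ)) γ t k := by fun_prop
    simpa [liftedCurve] using h2

theorem IsSimpleLoop.eq_or_eq {γ : unitInterval → E3} (hγ : IsSimpleLoop γ) {s t : unitInterval}
    (hst : s ≤ t) (h : γ s = γ t) : s = t ∨ s = 0 ∧ t = 1 := by
  by_cases ht : t = 1
  · by_cases hs : s = 1
    · exact Or.inl (hs.trans ht.symm)
    · refine Or.inr ⟨?_, ht⟩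
      refine hγ.injOn ⟨unitInterval.nonneg', lt_of_le_of_ne unitInterval.le_one' hs⟩
        ⟨le_rfl, zero_lt_one⟩ ?_
      rw [h, ht, hγ.closed]
  · have ht' : t < 1 := lt_of_le_of_ne unitInterval.le_one' ht
    exact Or.inl (hγ.injOn ⟨unitInterval.nonneg', hst.trans_lt ht'⟩ ⟨unitInterval.nonneg', ht'⟩ h)

/-- For every continuous `m` with `m 0 = 0` and `m 1 = 1`, thought of as the distribution function of
a mass on `[0, 1]`, a simple loop inscribes a parallelogram whose vertices cut the loop into four
arcs such that the opposite arcs `ab` and `cd` have total mass `1/2`. This mass condition excludes all coincidences among the vertices. -/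
theorem IsSimpleLoop.exists_inscribes_of_mass {γ : unitInterval → E3} (hγ : IsSimpleLoop γ)
    {m : ℝ → ℝ} (hm : Continuous m) (h0 : m 0 = 0) (h1 : m 1 = 1) :
    ∃ a b c d : unitInterval, Inscribes γ ![γ a, γ b, γ c, γ d] ∧
      m b - m a + (m d - m c) = 1 / 2 := by
  obtain ⟨a, b, c, d, ha, hab, hbc, hcd, hd, h⟩ :=
    exists_half_increment (continuous_liftedCurve hγ.continuous hm)
  lift a to unitInterval using ⟨ha, by linarith⟩
  lift b to unitInterval using ⟨by linarith, by linarith⟩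
  lift c to unitInterval using ⟨by linarith, by linarith⟩
  lift d to unitInterval using ⟨by linarith, hd⟩
  replace hab : a ≤ b := hab
  replace hbc : b ≤ c := hbc
  replace hcd : c ≤ d := hcd
  have hmass : m b - m a + (m d - m c) = 1 / 2 := by
    have := congrFun h 0
    simp only [liftedCurve, Pi.smul_apply, Pi.add_apply, Pi.sub_apply, Fin.cons_zero,
      smul_eq_mul, h0, h1] at this
    linarith
  have hpar : γ b - γ a = γ c - γ d := by
    have e0 : Set.IccExtend (zero_le_one (α := ℝ)) γ 0 = γ 0 :=
      Set.IccExtend_val zero_le_one γ 0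
    have e1 : Set.IccExtend (zero_le_one (α := ℝ)) γ 1 = γ 1 :=
      Set.IccExtend_val zero_le_one γ 1
    ext k
    have := congrFun h k.succ
    simp only [liftedCurve, Pi.smul_apply, Pi.add_apply, Pi.sub_apply, Fin.cons_succ,
      smul_eq_mul, Set.IccExtend_val, e0, e1, hγ.closed, sub_self] at this
    simp only [PiLp.sub_apply]
    linarith
  have hab' : γ a ≠ γ b := by
    intro e
    have e' : γ c = γ d := by rwa [e, sub_self, eq_comm, sub_eq_zero] at hpar
    rcases hγ.eq_or_eq hab e with rfl | ⟨rfl, rfl⟩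
    · rcases hγ.eq_or_eq hcd e' with rfl | ⟨rfl, rfl⟩
      · norm_num at hmass
      · norm_num [h0, h1] at hmass
    · obtain rfl : c = 1 := le_antisymm unitInterval.le_one' hbc
      obtain rfl : d = 1 := le_antisymm unitInterval.le_one' hcd
      norm_num [h0, h1] at hmass
  have hcd' : γ c ≠ γ d := fun e => hab' (by rwa [e, sub_self, sub_eq_zero, eq_comm] at hpar)
  have hbc' : γ b ≠ γ c := by
    intro e
    have e' : γ a = γ d := by rwa [e, sub_right_inj] at hpar
    rcases hγ.eq_or_eq hbc e with rfl | ⟨rfl, rfl⟩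
    · rcases hγ.eq_or_eq (hab.trans hcd) e' with rfl | ⟨rfl, rfl⟩
      · exact hab' (by rw [le_antisymm hab hcd])
      · norm_num [h0, h1] at hmass
    · obtain rfl : a = 0 := le_antisymm hab unitInterval.nonneg'
      exact hab' rfl
  have had' : γ a ≠ γ d := fun e => hbc' (by rwa [e, sub_left_inj] at hpar)
  have hac' : γ a ≠ γ c := by
    intro e
    rcases hγ.eq_or_eq (hab.trans hbc) e with rfl | ⟨rfl, rfl⟩
    · exact hab' (by rw [le_antisymm hab hbc])
    · exact hcd' (by rw [le_antisymm hcd unitInterval.le_one'])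
  have hbd' : γ b ≠ γ d := by
    intro e
    rcases hγ.eq_or_eq (hbc.trans hcd) e with rfl | ⟨rfl, rfl⟩
    · exact hbc' (by rw [le_antisymm hbc hcd])
    · exact hab' (by rw [le_antisymm hab unitInterval.nonneg'])
  have hinj : Function.Injective ![γ a, γ b, γ c, γ d] := by
    intro i j hij
    fin_cases i <;> fin_cases j <;>
      simp [hab', hab'.symm, hbc', hbc'.symm, hcd', hcd'.symm, had', had'.symm, hac', hac'.symm,
        hbd', hbd'.symm] at hij ⊢
  refine ⟨a, b, c, d, ⟨isParallelogram_of_injective hinj hpar, fun i => ?_⟩, hmass⟩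
  fin_cases i
  exacts [⟨a, rfl⟩, ⟨b, rfl⟩, ⟨c, rfl⟩, ⟨d, rfl⟩]

/-- Placing all the mass on a short arc forces a vertex of the parallelogram into this arc. -/
theorem IsSimpleLoop.mem_closure_inscribedVertices {γ : unitInterval → E3} (hγ : IsSimpleLoop γ)
    (t : unitInterval) : γ t ∈ closure (inscribedVertices γ) := by
  rw [Metric.mem_closure_iff]
  intro ε hε
  obtain ⟨δ, hδ, hclose⟩ := Metric.continuous_iff.1 hγ.continuous t ε hε
  have ht0 : (0 : ℝ) ≤ t := t.2.1
  have ht1 : (t : ℝ) ≤ 1 := t.2.2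
  set u : ℝ := max 0 (t - δ / 2) with hu
  set v : ℝ := min 1 (t + δ / 2) with hv
  have hu0 : 0 ≤ u := le_max_left _ _
  have hut : t - δ / 2 ≤ u := le_max_right _ _
  have hv1 : v ≤ 1 := min_le_left _ _
  have hvt : v ≤ t + δ / 2 := min_le_right _ _
  have huv : u < v := by
    refine max_lt (lt_min one_pos (by linarith)) (lt_min (by linarith) (by linarith))
  set m : ℝ → ℝ := fun s => max 0 (min 1 ((s - u) / (v - u))) with hm
  have hpos : 0 < v - u := sub_pos.2 huv
  have hlow : ∀ s ≤ u, m s = 0 := fun s hs =>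
    max_eq_left ((min_le_right _ _).trans (div_nonpos_of_nonpos_of_nonneg (by linarith) hpos.le))
  have hhigh : ∀ s, v ≤ s → m s = 1 := fun s hs => by
    have : 1 ≤ (s - u) / (v - u) := by rw [one_le_div hpos]; linarith
    simp [hm, min_eq_left this]
  obtain ⟨a, b, c, d, hins, hmass⟩ := hγ.exists_inscribes_of_mass (m := m) (by fun_prop)
    (hlow 0 hu0) (hhigh 1 hv1)
  have hnear : ∀ s : unitInterval, u < s → s < v → dist (γ t) (γ s) < ε := fun s h1 h2 => by
    rw [dist_comm]
    refine hclose s ?_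
    rw [Subtype.dist_eq, Real.dist_eq, abs_lt]
    constructor <;> linarith
  have hout : ∀ s : unitInterval, ¬ dist (γ t) (γ s) < ε → m s = 0 ∨ m s = 1 := fun s hs => by
    rcases le_or_gt (s : ℝ) u with h | h
    · exact Or.inl (hlow s h)
    · exact Or.inr (hhigh s (not_lt.1 fun h' => hs (hnear s h h')))
  by_contra! hfar
  have hfar' : ∀ s : unitInterval, γ s ∈ Set.range ![γ a, γ b, γ c, γ d] → m s = 0 ∨ m s = 1 :=
    fun s hs => hout s (not_lt.2 (hfar (γ s) ⟨_, hins, hs⟩))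
  rcases hfar' a ⟨0, rfl⟩ with ha | ha <;> rcases hfar' b ⟨1, rfl⟩ with hb | hb <;>
    rcases hfar' c ⟨2, rfl⟩ with hc | hc <;> rcases hfar' d ⟨3, rfl⟩ with hd | hd <;>
    rw [ha, hb, hc, hd] at hmass <;> norm_num at hmass

theorem theorem2p4 (γ : unitInterval → E3) (hγ : IsSimpleLoop γ) :
    (∃ P : Fin 4 → E3, Inscribes γ P) ∧
      inscribedVertices γ ⊆ Set.range γ ∧ Set.range γ ⊆ closure (inscribedVertices γ) := by
  refine ⟨?_, ?_, ?_⟩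
  · obtain ⟨x, P, hP, -⟩ := closure_nonempty_iff.1 ⟨_, hγ.mem_closure_inscribedVertices 0⟩
    exact ⟨P, hP⟩
  · rintro _ ⟨P, hP, i, rfl⟩
    exact hP.2 i
  · rintro _ ⟨t, rfl⟩
    exact hγ.mem_closure_inscribedVertices t
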